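/- Let $K$ be an algebraically closed field and let $n\ge 1$, $k\ge 1$ be integers. Let $Q$ be the cyclic quiver with vertex set $\mathbb{Z}/n\mathbb{Z}$ and exactly one arrow $\alpha_i\colon i\to i+1$ for each $i$ (and no others), and let $A=KQ/I$ be the Brauer star algebra with $n$ vertices and multiplicity $k$, where $I$ is the two-sided ideal generated by the elements $(\alpha_i\alpha_{i+1}\cdots\alpha_{i-1})^k\alpha_i$, $i\in\mathbb{Z}/n\mathbb{Z}$ (in a product $ab$ of paths, $a$ is followed by $b$; the product in the bracket has $n$ factors). Let $M$ be a finitely generated, indecomposable, non-projective left $A$-module of length $l(M)$, and let $$T:\quad \cdots\to 0\to P^0\xrightarrow{\ f\ } P^1\to 0\to\cdots$$ be its minimal projective presentation, with $P^0$ in degree $0$ and $P^1$ in degree $1$; that is, $P^1\to M$ is a projective cover with kernel $\operatorname{Im} f$, and $P^0\to \operatorname{Im} f$ is a projective cover. Call an object $X$ of the derived category of $A$ a partial tilting complex if it is perfect (isomorphic to a bounded complex of finitely generated projective $A$-modules) and $\operatorname{Hom}(X,X[i])=0$ for all $i\ne 0$. Then $T$ is a partial tilting complex if and only if $l(M)<n$.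 -/

import Mathlib

open CategoryTheory

universe w u

noncomputable section

/-! ### Path algebras -/

/-- All paths of a quiver `V` (including the paths of length zero), with source `p.1` and
target `p.2.1`. -/
abbrev Quiver.AnyPath (V : Type) [Quiver.{0} V] : Type := Σ a b : V, Quiver.Path a b

/-- The path algebra `K V` of a quiver `V`: the `K`-vector space with basis the paths of `V`. -/
def PathAlgebra (K : Type u) [Field K] (V : Type) [Quiver.{0} V] : Type u :=
  Quiver.AnyPath V →₀ K

namespace PathAlgebra

variable (K : Type u) [Field K] {V : Type} [Quiver.{0} V]

instance : AddCommGroup (PathAlgebra K V) := inferInstanceAs (AddCommGroup (_ →₀ K))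

instance : Module K (PathAlgebra K V) := inferInstanceAs (Module K (_ →₀ K))

/-- The basis element of the path algebra given by a path. -/
def of (p : Quiver.AnyPath V) : PathAlgebra K V := Finsupp.single p 1

open scoped Classical in
/-- The product `p q` of two paths: first `p`, then `q` if `q` starts where `p` ends, and zero
otherwise. -/
def pathMul (p q : Quiver.AnyPath V) : PathAlgebra K V :=
  if h : q.1 = p.2.1 then of K ⟨p.1, q.2.1, p.2.2.comp (q.2.2.cast h rfl)⟩ else 0

/-- The bilinear extension of the product of paths. -/
def mulHom : PathAlgebra K V →ₗ[K] PathAlgebra K V →ₗ[K] PathAlgebra K V :=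
  Finsupp.linearCombination K fun p => Finsupp.linearCombination K fun q => pathMul K p q

instance : Mul (PathAlgebra K V) := ⟨fun x y => mulHom K x y⟩

/-- The unit is the sum of the paths of length zero. -/
instance [Fintype V] : One (PathAlgebra K V) :=
  ⟨∑ a : V, of K ⟨a, a, Quiver.Path.nil⟩⟩

theorem mul_def (x y : PathAlgebra K V) : x * y = mulHom K x y := rfl

theorem one_def [Fintype V] :
    (1 : PathAlgebra K V) = ∑ a : V, of K ⟨a, a, Quiver.Path.nil⟩ := rfl

theorem of_mul_of (p q : Quiver.AnyPath V) : of K p * of K q = pathMul K p q := by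
  rw [mul_def]
  unfold mulHom of
  erw [Finsupp.linearCombination_single, one_smul, Finsupp.linearCombination_single, one_smul]

theorem of_mul_of_comp {a b c : V} (p : Quiver.Path a b) (q : Quiver.Path b c) :
    of K ⟨a, b, p⟩ * of K ⟨b, c, q⟩ = of K ⟨a, c, p.comp q⟩ := by
  rw [of_mul_of, pathMul, dif_pos rfl]
  rfl

theorem of_mul_of_ne {a b b' c : V} (p : Quiver.Path a b) (q : Quiver.Path b' c) (h : b' ≠ b) :
    of K ⟨a, b, p⟩ * of K ⟨b', c, q⟩ = 0 := by
  rw [of_mul_of, pathMul, dif_neg h]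

@[elab_as_elim]
theorem induction_on {P : PathAlgebra K V → Prop} (x : PathAlgebra K V) (zero : P 0)
    (add : ∀ x y, P x → P y → P (x + y)) (smul : ∀ (c : K) p, P (c • of K p)) : P x := by
  refine Finsupp.induction_linear (motive := P) x zero add fun p c => ?_
  have h : (Finsupp.single p c : PathAlgebra K V) = c • of K p := by
    unfold of
    erw [Finsupp.smul_single]
    simp
  exact h ▸ smul c p

theorem path_mul_assoc (p q r : Quiver.AnyPath V) :
    of K p * of K q * of K r = of K p * (of K q * of K r) := by
  obtain ⟨a, b, p⟩ := p
  obtain ⟨b', c, q⟩ := q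
  obtain ⟨c', d, r⟩ := r
  have mz : ∀ x : PathAlgebra K V, x * 0 = 0 := fun x => map_zero (mulHom K x)
  have zm : ∀ x : PathAlgebra K V, 0 * x = 0 := fun x => by simp [mul_def]
  by_cases h₁ : b' = b
  · subst h₁
    by_cases h₂ : c' = c
    · subst h₂
      simp only [of_mul_of_comp, Quiver.Path.comp_assoc]
    · rw [of_mul_of_comp, of_mul_of_ne K _ _ h₂, of_mul_of_ne K _ _ h₂, mz]
  · rw [of_mul_of_ne K _ _ h₁, zm]
    by_cases h₂ : c' = c
    · subst h₂
      rw [of_mul_of_comp, of_mul_of_ne K _ _ h₁]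
    · rw [of_mul_of_ne K _ _ h₂, mz]

instance [Fintype V] : Ring (PathAlgebra K V) :=
  { (inferInstance : AddCommGroup (PathAlgebra K V)),
    (inferInstance : Mul (PathAlgebra K V)),
    (inferInstance : One (PathAlgebra K V)) with
    left_distrib := fun x y z => map_add (mulHom K x) y z
    right_distrib := fun x y z => by simp [mul_def]
    zero_mul := fun x => by simp [mul_def]
    mul_zero := fun x => map_zero (mulHom K x)
    mul_assoc := fun x y z => by
      induction x using induction_on with
      | zero => simp [mul_def]
      | add x x' hx hx' => simp only [mul_def, map_add, LinearMap.add_apply] at *; rw [hx, hx']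
      | smul c p =>
      induction y using induction_on with
      | zero => simp [mul_def]
      | add x x' hx hx' => simp only [mul_def, map_add, LinearMap.add_apply] at *; rw [hx, hx']
      | smul c' q =>
      induction z using induction_on with
      | zero => simp [mul_def]
      | add x x' hx hx' => simp only [mul_def, map_add] at *; rw [hx, hx']
      | smul c'' r =>
      have := path_mul_assoc K p q r
      simp only [mul_def, map_smul, LinearMap.smul_apply] at *
      rw [this]
    one_mul := fun x => by
      induction x using induction_on with
      | zero => simp [mul_def]
      | add x x' hx hx' => simp only [mul_def, map_add] at *; rw [hx, hx']
      | smul c p =>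
      classical
      obtain ⟨a, b, p⟩ := p
      have h : ∀ a' : V, mulHom K (of K ⟨a', a', Quiver.Path.nil⟩) (of K ⟨a, b, p⟩) =
          if a' = a then of K ⟨a, b, p⟩ else 0 := fun a' => by
        rw [← mul_def]
        split_ifs with h
        · subst h
          rw [of_mul_of_comp, Quiver.Path.nil_comp]
        · exact of_mul_of_ne K _ _ (Ne.symm h)
      simp only [mul_def, one_def, map_sum, LinearMap.sum_apply, map_smul, h]
      simp
    mul_one := fun x => by
      induction x using induction_on with
      | zero => simp [mul_def]
      | add x x' hx hx' => simp only [mul_def, map_add, LinearMap.add_apply] at *; rw [hx, hx']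
      | smul c p =>
      classical
      obtain ⟨a, b, p⟩ := p
      have h : ∀ a' : V, mulHom K (of K ⟨a, b, p⟩) (of K ⟨a', a', Quiver.Path.nil⟩) =
          if a' = b then of K ⟨a, b, p⟩ else 0 := fun a' => by
        rw [← mul_def]
        split_ifs with h
        · subst h
          rw [of_mul_of_comp, Quiver.Path.comp_nil]
        · exact of_mul_of_ne K _ _ h
      simp only [mul_def, one_def, map_sum, LinearMap.smul_apply, map_smul, h]
      simp }

instance [Fintype V] : Algebra K (PathAlgebra K V) :=
  Algebra.ofModule
    (fun c x y => by
      change mulHom K (c • x) y = c • mulHom K x y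
      simp)
    (fun c x y => map_smul (mulHom K x) c y)

end PathAlgebra

/-! ### Brauer star algebras -/

/-- The cyclic quiver with vertex set `ZMod n`: there is exactly one arrow `i ⟶ i + 1` for each `i`,
and there are no other arrows. -/
instance cyclicQuiver (n : ℕ) : Quiver.{0} (ZMod n) := ⟨fun i j => PLift (j = i + 1)⟩

/-- The arrow `i ⟶ i + 1` of the cyclic quiver. -/
def cyclicQuiver.arrow (n : ℕ) (i : ZMod n) : i ⟶ i + 1 := PLift.up rfl

namespace BrauerStar

variable (K : Type u) [Field K] (n : ℕ) [NeZero n]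

/-- The arrow `α i : i ⟶ i + 1` as an element of the path algebra of the cyclic quiver. -/
def α (i : ZMod n) : PathAlgebra K (ZMod n) :=
  PathAlgebra.of K ⟨i, i + 1, (cyclicQuiver.arrow n i).toPath⟩

/-- The full cycle `α i * α (i + 1) * ⋯ * α (i - 1)` (`n` factors) from `i` to `i`. -/
def cycle (i : ZMod n) : PathAlgebra K (ZMod n) :=
  ((List.range n).map fun j : ℕ => α K n (i + (j : ZMod n))).prod

/-- The two-sided ideal generated by the elements `(α i * α (i + 1) * ⋯ * α (i - 1)) ^ k * α i`. -/
def relations (k : ℕ) : TwoSidedIdeal (PathAlgebra K (ZMod n)) :=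
  TwoSidedIdeal.span (Set.range fun i : ZMod n => cycle K n i ^ k * α K n i)

end BrauerStar

/-- The Brauer star algebra with `n` vertices and multiplicity `k`: the path algebra of the cyclic
quiver with `n` vertices modulo the ideal `BrauerStar.relations K n k`. -/
abbrev BrauerStarAlgebra (K : Type u) [Field K] (n : ℕ) [NeZero n] (k : ℕ) : Type u :=
  (BrauerStar.relations K n k).ringCon.Quotient

/-! ### Minimal projective presentations -/

/-- `π : P → M` is a projective cover: `P` is projective, `π` is surjective, and the kernel of `π`
is superfluous in `P`. -/
structure IsProjectiveCover {A : Type u} [Ring A] {P M : Type u} [AddCommGroup P] [Module A P]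
    [AddCommGroup M] [Module A M] (π : P →ₗ[A] M) : Prop where
  projective : Module.Projective A P
  surjective : Function.Surjective π
  superfluous : ∀ N : Submodule A P, N ⊔ LinearMap.ker π = ⊤ → N = ⊤

/-- A minimal projective presentation `P⁰ ⟶ P¹ ⟶ M ⟶ 0` of `M` by finitely generated modules:
an exact sequence such that `P¹ ⟶ M` is a projective cover of `M` and `P⁰` is a projective cover of
the kernel of `P¹ ⟶ M`. -/
structure MinimalProjectivePresentation {A : Type u} [Ring A] (M : ModuleCat.{u} A) where
  P₀ : ModuleCat.{u} A
  P₁ : ModuleCat.{u} A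
  f : P₀ ⟶ P₁
  π : P₁ ⟶ M
  finite₀ : Module.Finite A P₀
  finite₁ : Module.Finite A P₁
  exact : LinearMap.range f.hom = LinearMap.ker π.hom
  cover₁ : IsProjectiveCover π.hom
  cover₀ : IsProjectiveCover f.hom.rangeRestrict

/-- The two-term complex `⋯ ⟶ 0 ⟶ P⁰ ⟶ P¹ ⟶ 0 ⟶ ⋯`, with `P⁰` in degree `0` and `P¹` in
degree `1`. -/
def MinimalProjectivePresentation.complex {A : Type u} [Ring A] {M : ModuleCat.{u} A}
    (T : MinimalProjectivePresentation M) : CochainComplex (ModuleCat.{u} A) ℤ :=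
  HomologicalComplex.double T.f (c := ComplexShape.up ℤ) (i₀ := 0) (i₁ := 1) (by simp)

/-! ### Partial tilting complexes -/

/-- An object of the derived category is perfect if it is isomorphic to a bounded complex of
finitely generated projective modules. -/
def IsPerfect {A : Type u} [Ring A] [HasDerivedCategory.{w} (ModuleCat.{u} A)]
    (X : DerivedCategory (ModuleCat.{u} A)) : Prop :=
  ∃ C : CochainComplex (ModuleCat.{u} A) ℤ,
    (∃ a b : ℤ, ∀ i : ℤ, i < a ∨ b < i → Limits.IsZero (C.X i)) ∧
    (∀ i : ℤ, Module.Finite A (C.X i) ∧ Module.Projective A (C.X i)) ∧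
    Nonempty (X ≅ DerivedCategory.Q.obj C)

/-- An object `X` of the derived category is a partial tilting complex if it is perfect and
`Hom (X, X[i]) = 0` for all `i ≠ 0`. -/
def IsPartialTilting {A : Type u} [Ring A] [HasDerivedCategory.{w} (ModuleCat.{u} A)]
    (X : DerivedCategory (ModuleCat.{u} A)) : Prop :=
  IsPerfect X ∧ ∀ i : ℤ, i ≠ 0 → ∀ φ : X ⟶ (shiftFunctor _ i).obj X, φ = 0

end

/-!
Write `x` for the sum of the arrows and `e i` for the vertices of the cyclic quiver. Then
`e i * x = x * e (i + 1)`, and the relations of the Brauer star algebra `A` say precisely that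
`x ^ (n * k + 1) = 0`; the elements `x ^ t * e j` with `t ≤ n * k` form a basis
(`BrauerStar.cyclicPresentation`). So an `A`-module is a vector space graded by `ZMod n` with a
nilpotent operator `x` lowering the degree by one, and it behaves like a module over a truncated
polynomial ring: a homogeneous element of maximal order generates a direct summand
(`CyclicPresentation.HasOrder.exists_retraction`). Hence an indecomposable module is generated by one
homogeneous element `m`, and if `l` is the least exponent with `x ^ l • m = 0`, its length is `l`.

For such a module with `m` at the vertex `i`, projective covers are again generated by one homogeneous
element, of maximal order `n * k + 1`. So the minimal presentation is `P₀ = A p₀ → P₁ = A p₁` with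
`p₁` at `i`, `p₀` at `i - l`, `p₀ ↦ x ^ l • p₁`, and `0 < l ≤ n * k` as the module is not projective
(`CyclicPresentation.exists_generators_of_minimalProjectivePresentation`).

As this complex `T` is K-projective, `Hom (T, T[j])` in the derived category is computed by homotopy
classes of morphisms of complexes, and only `j = 1` and `j = -1` matter.
* For `j = 1` the question is whether each morphism `P₀ → P₁` is of the form `f ∘ a + b ∘ f`. The
  morphisms `P₀ → P₁` are combinations of the `p₀ ↦ x ^ t • p₁` with `t ≡ l` modulo `n`. If `l < n`,
  then all these `t` are at least `l` and every morphism factors through `f`; if `n ≤ l`, the morphism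
  given by `t = l - n` is not of that form.
* For `j = -1` one considers `g : P₁ → P₀` with `g ∘ f = 0`. Such a `g` is a combination of the
  `p₁ ↦ x ^ t • p₀` with `n ∣ t + l` and `t + l > n * k`. If `l < n`, then
  `t ≥ n * k + n - l > n * k` and `g = 0`.
-/

/-! ### Morphisms in the derived category out of a complex of projectives -/

namespace CochainComplex

open HomComplex

universe v' u'

variable {C : Type u'} [Category.{v'} C] [Abelian C] [HasDerivedCategory.{w} C]

/-- Morphisms `X ⟶ Y⟦i⟧` in the derived category are classes of degree `i` cocycles modulo
coboundaries when `X` is K-projective. -/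
theorem IsKProjective.forall_Q_hom_shift_eq_zero_iff (X Y : CochainComplex C ℤ) [X.IsKProjective]
    (i : ℤ) :
    (∀ φ : DerivedCategory.Q.obj X ⟶
        (CategoryTheory.shiftFunctor _ i).obj (DerivedCategory.Q.obj Y), φ = 0) ↔
      ∀ z : Cocycle X Y i, z ∈ coboundaries X Y i := by
  let e := Iso.homCongr ((DerivedCategory.quotientCompQhIso C).app X)
      ((DerivedCategory.quotientCompQhIso C).app (Y⟦i⟧) ≪≫
        (DerivedCategory.Q.commShiftIso i).app Y)
  have hb := e.bijective.comp ((IsKProjective.Qh_map_bijective X _).comp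
    (CohomologyClass.toHom_bijective X Y i))
  have h0 : (e ∘ DerivedCategory.Qh.map ∘ CohomologyClass.toHom)
      (0 : CohomologyClass X Y i) = 0 := by
    simp only [Function.comp_apply, map_zero, Functor.map_zero, e, Iso.homCongr_apply]
    simp
  constructor
  · intro h z
    rw [← CohomologyClass.mk_eq_zero_iff]
    exact hb.injective ((h _).trans (h _).symm)
  · intro h φ
    obtain ⟨c, rfl⟩ := hb.surjective φ
    obtain ⟨z, rfl⟩ := c.mk_surjective
    rw [(CohomologyClass.mk_eq_zero_iff z).2 (h z), h0]

end CochainComplex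

/-! ### Self-extensions of a two-term complex -/

namespace HomologicalComplex

open CochainComplex CochainComplex.HomComplex

universe v' u'

variable {C : Type u'} [Category.{v'} C] [Abelian C] {P₀ P₁ : C} (f : P₀ ⟶ P₁)

/-- Induction principle for the terms of a two-term complex. -/
theorem double_X_cases {P : C → Prop} (h₀ : P P₀) (h₁ : P P₁) (hz : ∀ Z, Limits.IsZero Z → P Z)
    (hiso : ∀ {Y Z : C}, (Y ≅ Z) → P Y → P Z) (h : (ComplexShape.up ℤ).Rel 0 1) (i : ℤ) :
    P ((double f h).X i) := by
  by_cases hi : i = 0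
  · subst hi; exact hiso (doubleXIso₀ f h).symm h₀
  by_cases hi' : i = 1
  · subst hi'; exact hiso (doubleXIso₁ f h (by simp)).symm h₁
  exact hz _ (isZero_double_X f h i hi hi')

theorem isKProjective_double [Projective P₀] [Projective P₁] (h : (ComplexShape.up ℤ).Rel 0 1) :
    CochainComplex.IsKProjective (double f h) := by
  have : CochainComplex.IsStrictlyLE (double f h) 1 := by
    rw [CochainComplex.isStrictlyLE_iff]
    exact fun i hi => isZero_double_X f h i (by lia) (by lia)
  have (i : ℤ) : Projective ((double f h).X i) :=
    double_X_cases f (P := fun Z => Projective Z) ‹_› ‹_› (fun Z hZ => hZ.projective)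
      (fun e hp => Projective.of_iso e hp) h i
  exact CochainComplex.isKProjective_of_projective _ 1

/-- A complex in degrees `0` and `1` has only cochains of degree `-1`, `0` and `1` to itself. -/
theorem cochain_double_eq_zero (h : (ComplexShape.up ℤ).Rel 0 1) {i : ℤ} (h₁ : i ≠ 1) (h₀ : i ≠ 0)
    (hneg : i ≠ -1) (z : Cochain (double f h) (double f h) i) : z = 0 := by
  ext p q hpq
  by_cases hp : p = 0 ∨ p = 1
  · exact (isZero_double_X f h q (by lia) (by lia)).eq_of_tgt _ _
  · exact (isZero_double_X f h p (by lia) (by lia)).eq_of_src _ _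

/-- A degree `1` cochain of `P₀ ⟶ P₁` is a morphism `P₀ ⟶ P₁`; it is always a cocycle, and it is a
coboundary when it is a sum of two morphisms factoring through `f`, one on each side. -/
theorem forall_mem_coboundaries_double_one_iff (h : (ComplexShape.up ℤ).Rel 0 1) :
    (∀ z : Cocycle (double f h) (double f h) 1, z ∈ coboundaries _ _ 1) ↔
      ∀ g : P₀ ⟶ P₁, ∃ (a : P₀ ⟶ P₀) (b : P₁ ⟶ P₁), g = a ≫ f + f ≫ b := by
  have h01 : (0 : ℤ) ≠ 1 := by simp
  have key (β : Cochain (double f h) (double f h) 0) :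
      (δ 0 1 β).v 0 1 (by simp) = (doubleXIso₀ f h).hom ≫
        (((doubleXIso₀ f h).inv ≫ β.v 0 0 (by simp) ≫ (doubleXIso₀ f h).hom) ≫ f +
          f ≫ ((-(doubleXIso₁ f h h01).inv) ≫ β.v 1 1 (by simp) ≫ (doubleXIso₁ f h h01).hom)) ≫
        (doubleXIso₁ f h h01).inv := by
    rw [δ_v 0 1 (by simp) β 0 1 (by simp) 0 1 (by simp) (by simp), double_d f h h01]
    simp [Preadditive.add_comp, Preadditive.comp_add]
  constructor
  · intro H g
    obtain ⟨β, hβ⟩ := (mem_coboundaries_iff _ 0 (by simp)).1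
      (H (Cocycle.mk (Cochain.single ((doubleXIso₀ f h).hom ≫ g ≫ (doubleXIso₁ f h h01).inv) 1)
        2 (by simp) (cochain_double_eq_zero f h (by simp) (by simp) (by simp) _)))
    have := Cochain.congr_v hβ 0 1 (by simp)
    rw [key, Cocycle.mk_coe, Cochain.single_v] at this
    exact ⟨_, _, ((cancel_mono _).1 ((cancel_epi _).1 (this.trans (by simp)))).symm⟩
  · intro H z
    obtain ⟨a, b, hab⟩ := H ((doubleXIso₀ f h).inv ≫ z.1.v 0 1 (by simp) ≫
      (doubleXIso₁ f h h01).hom)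
    refine (mem_coboundaries_iff _ 0 (by simp)).2
      ⟨Cochain.single ((doubleXIso₀ f h).hom ≫ a ≫ (doubleXIso₀ f h).inv) 0 -
        Cochain.single ((doubleXIso₁ f h h01).hom ≫ b ≫ (doubleXIso₁ f h h01).inv) 0, ?_⟩
    ext p q hpq
    by_cases hp : p = 0
    · obtain rfl := hp
      obtain rfl : q = 1 := by lia
      rw [key]
      rw [Cochain.sub_v, Cochain.sub_v, Cochain.single_v, Cochain.single_v,
        Cochain.single_v_eq_zero _ _ _ _ _ h01, Cochain.single_v_eq_zero _ _ _ _ _ h01.symm]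
      simp only [sub_zero, zero_sub, Preadditive.comp_neg, Preadditive.neg_comp, neg_neg,
        Category.assoc, Iso.inv_hom_id, Iso.inv_hom_id_assoc, Category.comp_id]
      rw [← hab]
      simp
    · by_cases hp' : p = 1
      · exact (isZero_double_X f h q (by lia) (by lia)).eq_of_tgt _ _
      · exact (isZero_double_X f h p hp hp').eq_of_src _ _

/-- A degree `-1` cocycle of `P₀ ⟶ P₁` is a morphism `g : P₁ ⟶ P₀` whose composites with `f` on both
sides vanish. -/
theorem cocycle_double_neg_one_eq_zero (h : (ComplexShape.up ℤ).Rel 0 1)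
    (H : ∀ g : P₁ ⟶ P₀, f ≫ g = 0 → g ≫ f = 0 → g = 0)
    (z : Cocycle (double f h) (double f h) (-1)) : z = 0 := by
  have h01 : (0 : ℤ) ≠ 1 := by simp
  have hz := z.δ_eq_zero 0
  have h₀ := Cochain.congr_v hz 0 0 (by simp)
  have h₁ := Cochain.congr_v hz 1 1 (by simp)
  rw [δ_v (-1) 0 (by simp) _ 0 0 (by simp) (-1) 1 (by simp) (by simp), double_d f h h01,
    double_d_eq_zero₀ f h _ _ (by simp)] at h₀
  rw [δ_v (-1) 0 (by simp) _ 1 1 (by simp) 0 2 (by simp) (by simp), double_d f h h01,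
    double_d_eq_zero₀ f h _ _ (by simp)] at h₁
  simp only [Limits.comp_zero, zero_add, Limits.zero_comp, add_zero, smul_zero, Cochain.zero_v,
    Int.negOnePow_zero, one_smul] at h₀ h₁
  have hv : (doubleXIso₁ f h h01).inv ≫ z.1.v 1 0 (by simp) ≫ (doubleXIso₀ f h).hom = 0 := by
    apply H
    · rw [← cancel_epi (doubleXIso₀ f h).hom]
      simpa using h₀ =≫ (doubleXIso₀ f h).hom
    · rw [← cancel_mono (doubleXIso₁ f h h01).inv]
      simpa using (doubleXIso₁ f h h01).inv ≫= h₁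
  rw [← Limits.comp_zero, cancel_epi, ← Limits.zero_comp, cancel_mono] at hv
  apply Subtype.ext
  ext p q hpq
  by_cases hp : p = 1
  · obtain rfl := hp
    obtain rfl : q = 0 := by lia
    exact hv
  · by_cases hp' : p = 0
    · exact (isZero_double_X f h q (by lia) (by lia)).eq_of_tgt _ _
    · exact (isZero_double_X f h p hp' hp).eq_of_src _ _

end HomologicalComplex

/-! ### Modules over a truncated cyclic path algebra -/

/-- Generators exhibiting a `K`-algebra `A` as the path algebra of the cyclic quiver on `ZMod n`
modulo the paths of length greater than `L`: the vertices `e i` are orthogonal idempotents with sum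
`1`, and `x` stands for the sum of all arrows, so that `e i * x = x * e (i + 1)` is the arrow
`i ⟶ i + 1`. The elements `x ^ t * e j` span `A`, and each vertex is the end of a nonzero path of
length `L`. -/
structure CyclicPresentation (K : Type*) (A : Type*) [Field K] [Ring A] [Algebra K A] (n : ℕ)
    [NeZero n] (L : ℕ) where
  e : ZMod n → A
  x : A
  e_mul_e : ∀ i j, e i * e j = if i = j then e i else 0
  sum_e : ∑ i, e i = 1
  e_mul_x : ∀ i, e i * x = x * e (i + 1)
  x_pow : x ^ (L + 1) = 0
  x_pow_mul_e_ne_zero : ∀ i, x ^ L * e i ≠ 0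
  span_eq_top : Submodule.span K (Set.range fun p : ℕ × ZMod n => x ^ p.1 * e p.2) = ⊤

namespace CyclicPresentation

variable {K : Type*} {A : Type*} [Field K] [Ring A] [Algebra K A] {n : ℕ} [NeZero n] {L : ℕ}
  (S : CyclicPresentation K A n L)
  {V : Type*} [AddCommGroup V] [Module A V]

theorem e_mul_x_pow (i : ZMod n) (t : ℕ) : S.e i * S.x ^ t = S.x ^ t * S.e (i + t) := by
  induction t generalizing i with
  | zero => simp
  | succ t ih =>
    rw [pow_succ', ← mul_assoc, S.e_mul_x, mul_assoc, ih, mul_assoc]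
    congr 3
    push_cast
    ring

/-- The element `v` lies at the vertex `i` and `l` is the least exponent with `x ^ l • v = 0`;
the zero element has order `0`. -/
structure HasOrder (v : V) (i : ZMod n) (l : ℕ) : Prop where
  e_smul : S.e i • v = v
  x_pow_smul : S.x ^ l • v = 0
  x_pow_smul_ne : ∀ t < l, S.x ^ t • v ≠ 0

variable {S}

/-- An element at the vertex `i` has no component at another vertex. -/
theorem e_smul_of_ne {v : V} {i j : ZMod n} (hv : S.e i • v = v) (h : j ≠ i) : S.e j • v = 0 := by
  rw [← hv, smul_smul, S.e_mul_e, if_neg h, zero_smul]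

theorem e_smul_x_pow_smul (v : V) (i : ZMod n) (t : ℕ) :
    S.e i • S.x ^ t • v = S.x ^ t • S.e (i + t) • v := by
  rw [smul_smul, S.e_mul_x_pow, mul_smul]

theorem e_sub_smul_x_pow_smul {v : V} {i : ZMod n} (hv : S.e i • v = v) (t : ℕ) :
    S.e (i - t) • S.x ^ t • v = S.x ^ t • v := by
  rw [e_smul_x_pow_smul, sub_add_cancel, hv]

theorem x_pow_smul_eq_zero {v : V} {l t : ℕ} (h : S.x ^ l • v = 0) (ht : l ≤ t) :
    S.x ^ t • v = 0 := by
  rw [← Nat.sub_add_cancel ht, pow_add, mul_smul, h, smul_zero]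

variable (S) in
theorem exists_hasOrder {v : V} {i : ZMod n} (hv : S.e i • v = v) :
    ∃ l ≤ L + 1, S.HasOrder v i l := by
  classical
  have h : ∃ l, S.x ^ l • v = 0 := ⟨L + 1, by rw [S.x_pow, zero_smul]⟩
  exact ⟨Nat.find h, Nat.find_min' h (by rw [S.x_pow, zero_smul]), hv, Nat.find_spec h,
    fun t ht => Nat.find_min h ht⟩

theorem HasOrder.le {v : V} {i : ZMod n} {l : ℕ} (hv : S.HasOrder v i l) : l ≤ L + 1 := by
  by_contra! h
  exact hv.x_pow_smul_ne _ h (by rw [S.x_pow, zero_smul])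

theorem HasOrder.pos {v : V} {i : ZMod n} {l : ℕ} (hv : S.HasOrder v i l) (h : v ≠ 0) :
    0 < l := by
  rw [Nat.pos_iff_ne_zero]
  rintro rfl
  exact h (by simpa using hv.x_pow_smul)

theorem HasOrder.x_pow_smul_right {v : V} {i : ZMod n} {l t : ℕ} (hv : S.HasOrder v i l)
    (ht : t ≤ l) : S.HasOrder (S.x ^ t • v) (i - t) (l - t) := by
  refine ⟨e_sub_smul_x_pow_smul hv.e_smul t, ?_, fun s hs => ?_⟩
  · rw [smul_smul, ← pow_add, Nat.sub_add_cancel ht, hv.x_pow_smul]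
  · rw [smul_smul, ← pow_add]
    exact hv.x_pow_smul_ne _ (by lia)

/-- As an element of the regular module, each vertex has maximal order. -/
theorem hasOrder_e (i : ZMod n) : S.HasOrder (V := A) (S.e i) i (L + 1) := by
  refine ⟨by simp [S.e_mul_e], by simp [S.x_pow], fun t ht h => S.x_pow_mul_e_ne_zero i ?_⟩
  exact x_pow_smul_eq_zero h (by lia)

variable [Module K V] [IsScalarTower K A V]

theorem smul_tower_comm (c : K) (a : A) (v : V) : a • c • v = c • a • v := by
  rw [← algebraMap_smul A c v, ← algebraMap_smul A c (a • v), smul_smul, smul_smul,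
    Algebra.commutes]

/-- The submodule `A v` generated by an element at a vertex is spanned by the `x ^ t • v`. -/
theorem exists_eq_sum_of_mem_span {v w : V} {i : ZMod n} {l : ℕ} (hv : S.e i • v = v)
    (hl : S.x ^ l • v = 0) (hw : w ∈ Submodule.span A {v}) :
    ∃ c : ℕ → K, w = ∑ t ∈ Finset.range l, c t • S.x ^ t • v := by
  obtain ⟨a, rfl⟩ := Submodule.mem_span_singleton.1 hw
  have ha : a ∈ Submodule.span K (Set.range fun p : ℕ × ZMod n => S.x ^ p.1 * S.e p.2) := by
    rw [S.span_eq_top]; trivial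
  induction ha using Submodule.span_induction with
  | mem a ha =>
    obtain ⟨⟨t, j⟩, rfl⟩ := ha
    dsimp only
    rw [mul_smul]
    by_cases hj : j = i
    · subst hj
      rw [hv]
      by_cases ht : t < l
      · refine ⟨Pi.single t 1, ?_⟩
        rw [Finset.sum_eq_single_of_mem t (by simpa using ht)]
        · simp
        · intro s _ hs
          simp [Pi.single_eq_of_ne hs]
      · exact ⟨0, by simp [x_pow_smul_eq_zero hl (not_lt.1 ht)]⟩
    · exact ⟨0, by simp [e_smul_of_ne hv hj]⟩
  | zero => exact ⟨0, by simp⟩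
  | add a b _ _ ha hb =>
    obtain ⟨c, hc⟩ := ha (Submodule.smul_mem _ _ (Submodule.mem_span_singleton_self v))
    obtain ⟨d, hd⟩ := hb (Submodule.smul_mem _ _ (Submodule.mem_span_singleton_self v))
    exact ⟨c + d, by simp [add_smul, Finset.sum_add_distrib, ← hc, ← hd]⟩
  | smul r a _ ha =>
    obtain ⟨c, hc⟩ := ha (Submodule.smul_mem _ _ (Submodule.mem_span_singleton_self v))
    exact ⟨r • c, by simp [mul_smul, ← Finset.smul_sum, ← hc]⟩

/-- An element of `A v` at the vertex `j` only involves those powers of `x` that lead from the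
vertex of `v` to `j`. -/
theorem exists_eq_sum_of_mem_span_of_e_smul {v w : V} {i j : ZMod n} {l : ℕ}
    (hv : S.e i • v = v) (hl : S.x ^ l • v = 0) (hw : w ∈ Submodule.span A {v})
    (hj : S.e j • w = w) :
    ∃ c : ℕ → K, w = ∑ t ∈ Finset.range l, c t • S.x ^ t • v ∧
      ∀ t, c t ≠ 0 → i - t = j := by
  obtain ⟨c, hc⟩ := exists_eq_sum_of_mem_span (K := K) hv hl hw
  refine ⟨fun t => if i - t = j then c t else 0, ?_, fun t ht => by
    by_contra h; exact ht (if_neg h)⟩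
  rw [← hj, hc, Finset.smul_sum]
  refine Finset.sum_congr rfl fun t _ => ?_
  rw [smul_tower_comm]
  dsimp only
  split_ifs with h
  · rw [← h, e_sub_smul_x_pow_smul hv]
  · rw [e_smul_of_ne (e_sub_smul_x_pow_smul hv t) (Ne.symm h), smul_zero, zero_smul]

/-- The nonzero multiples `x ^ t • v` of a homogeneous element are linearly independent. -/
theorem HasOrder.coeff_eq_zero {v : V} {i : ZMod n} {l m : ℕ} (hv : S.HasOrder v i l) {c : ℕ → K}
    (h : ∑ t ∈ Finset.range m, c t • S.x ^ t • v = 0) {t : ℕ} (ht : t < l) (htm : t < m) :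
    c t = 0 := by
  induction t using Nat.strong_induction_on with
  | _ t ih =>
  -- `x ^ (l - 1 - t)` kills all later terms, and the earlier ones vanish by induction
  have h' := congrArg (S.x ^ (l - 1 - t) • ·) h
  simp only [Finset.smul_sum, smul_zero] at h'
  rw [Finset.sum_eq_single_of_mem t (by simpa using htm)] at h'
  · rw [smul_tower_comm, smul_smul, ← pow_add, smul_eq_zero] at h'
    exact h'.resolve_right (hv.x_pow_smul_ne _ (by lia))
  · intro s hs hst
    rcases lt_or_gt_of_ne hst with hlt | hgt
    · rw [ih s hlt (by lia) (by lia), zero_smul, smul_zero]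
    · rw [smul_tower_comm, smul_smul, ← pow_add,
        x_pow_smul_eq_zero hv.x_pow_smul (by lia), smul_zero]

theorem HasOrder.linearIndependent {v : V} {i : ZMod n} {l : ℕ} (hv : S.HasOrder v i l) :
    LinearIndependent K fun t : Fin l => S.x ^ (t : ℕ) • v := by
  rw [Fintype.linearIndependent_iff]
  intro g hg t
  have := hv.coeff_eq_zero (c := fun s => if h : s < l then g ⟨s, h⟩ else 0) (m := l) (by
    rw [Finset.sum_range, ← hg]; simp) t.2 t.2
  simpa using this

/-! ### Length of a module generated at a vertex -/

/-- A module generated by a homogeneous element of order `l` has dimension `l` over `K`, and it has a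
strict chain of `l` submodules over `A`, so its length is `l`. -/
theorem length_eq_of_hasOrder {v : V} {i : ZMod n} {l : ℕ} (hv : S.HasOrder v i l)
    (htop : Submodule.span A {v} = ⊤) : Module.length A V = l := by
  apply le_antisymm
  · have h1 : Module.length A V ≤ Module.length K V := by
      have := Submodule.length_le_length_restrictScalars (R := A) K (⊤ : Submodule A V)
      rwa [Module.length_top, Submodule.restrictScalars_top, Module.length_top] at this
    refine h1.trans ?_
    have hs : Function.Surjective
        (Fintype.linearCombination K fun t : Fin l => S.x ^ (t : ℕ) • v) := by
      intro w
      obtain ⟨c, hc⟩ := exists_eq_sum_of_mem_span (K := K) (w := w) hv.e_smul hv.x_pow_smul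
        (htop ▸ trivial)
      refine ⟨fun t => c t, ?_⟩
      rw [hc, Finset.sum_range, Fintype.linearCombination_apply]
    refine (Module.length_le_of_surjective _ hs).trans ?_
    rw [Module.length_eq_finrank]
    simp
  · -- the submodules generated by the elements `x ^ t • v` form a chain of length `l`
    have hlt (t : ℕ) (ht : t < l) :
        Submodule.span A {S.x ^ (t + 1) • v} < Submodule.span A {S.x ^ t • v} := by
      refine lt_of_le_of_ne ?_ fun h => ?_
      · rw [Submodule.span_singleton_le_iff_mem, pow_succ', mul_smul]
        exact Submodule.smul_mem _ _ (Submodule.mem_span_singleton_self _)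
      · have hm : S.x ^ t • v ∈ Submodule.span A {S.x ^ (t + 1) • v} :=
          h ▸ Submodule.mem_span_singleton_self _
        have ho := hv.x_pow_smul_right (t := t + 1) ht
        obtain ⟨c, hc⟩ := exists_eq_sum_of_mem_span (K := K) ho.e_smul ho.x_pow_smul hm
        refine hv.x_pow_smul_ne (l - 1) (by lia) ?_
        rw [show l - 1 = (l - 1 - t) + t by lia, pow_add, mul_smul, hc, Finset.smul_sum]
        refine Finset.sum_eq_zero fun s _ => ?_
        rw [smul_tower_comm, smul_smul, smul_smul, ← pow_add, ← pow_add,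
          x_pow_smul_eq_zero hv.x_pow_smul (by lia), smul_zero]
    let p : LTSeries (Submodule A V) :=
      { length := l
        toFun := fun t => Submodule.span A {S.x ^ (l - t) • v}
        step := fun t => by
          have := hlt (l - (t + 1)) (by lia)
          rw [show l - (t + 1) + 1 = l - t by lia] at this
          simpa using this }
    have := Order.LTSeries.length_le_krullDim p
    rw [← Module.coe_length] at this
    exact_mod_cast this

/-! ### Indecomposable modules -/

/-- A `K`-linear map is `A`-linear as soon as it commutes with `x` and the vertices. -/
theorem map_smul_of_commute {W : Type*} [AddCommGroup W] [Module A W] [Module K W]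
    [IsScalarTower K A W] (ρ : V →ₗ[K] W) (hx : ∀ v, ρ (S.x • v) = S.x • ρ v)
    (he : ∀ i v, ρ (S.e i • v) = S.e i • ρ v) (a : A) (v : V) : ρ (a • v) = a • ρ v := by
  have hpow (t : ℕ) (v : V) : ρ (S.x ^ t • v) = S.x ^ t • ρ v := by
    induction t with
    | zero => simp
    | succ t ih => rw [pow_succ', mul_smul, hx, ih, mul_smul]
  have ha : a ∈ Submodule.span K (Set.range fun p : ℕ × ZMod n => S.x ^ p.1 * S.e p.2) := by
    rw [S.span_eq_top]; trivial
  induction ha using Submodule.span_induction with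
  | mem a ha =>
    obtain ⟨⟨t, j⟩, rfl⟩ := ha
    simp [mul_smul, hpow, he]
  | zero => simp
  | add a b _ _ ha hb => simp [add_smul, ha, hb]
  | smul r a _ ha => simp [ha]

/-- A homogeneous element of maximal order generates a direct summand. If `v` has order `l`, and
`φ` is a linear form at the vertex of `x ^ (l - 1) • v` which is `1` on that element and vanishes
on the lower multiples of `v`, then `w ↦ ∑ t, φ (x ^ (l - 1 - t) • w) • x ^ t • v` is a retraction
onto `A v`. -/
theorem HasOrder.exists_retraction {v : V} {i : ZMod n} {l : ℕ} (hv : S.HasOrder v i l)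
    (hmax : ∀ w : V, S.x ^ l • w = 0) :
    ∃ ρ : V →ₗ[A] V, (∀ w, ρ w ∈ Submodule.span A {v}) ∧ ρ v = v := by
  rcases Nat.eq_zero_or_pos l with rfl | hl
  · exact ⟨0, by simp, by simpa using hv.x_pow_smul.symm⟩
  obtain ⟨g, hg⟩ := LinearMap.exists_leftInverse_of_injective
    (Fintype.linearCombination K fun t : Fin l => S.x ^ (t : ℕ) • v)
    (LinearMap.ker_eq_bot.2 hv.linearIndependent.fintypeLinearCombination_injective)
  have hg' (t : Fin l) : g (S.x ^ (t : ℕ) • v) = Pi.single t 1 := by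
    simpa using LinearMap.congr_fun hg (Pi.single t 1)
  let i' : ZMod n := i - (l - 1 : ℕ)
  let φ : V →ₗ[K] K := LinearMap.proj (⟨l - 1, by lia⟩ : Fin l) ∘ₗ g ∘ₗ
    (Algebra.lsmul K K V (S.e i'))
  have hφe (j : ZMod n) (w : V) : φ (S.e j • w) = if i' = j then φ w else 0 := by
    simp only [φ, LinearMap.comp_apply, Algebra.lsmul_coe, smul_smul, S.e_mul_e]
    split_ifs with h <;> simp
  have hφv (t : ℕ) (ht : t < l) : φ (S.x ^ t • v) = if t = l - 1 then 1 else 0 := by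
    split_ifs with h
    · subst h
      simp only [φ, LinearMap.comp_apply, Algebra.lsmul_coe, i']
      rw [e_sub_smul_x_pow_smul hv.e_smul, hg' ⟨l - 1, ht⟩]
      simp
    · by_cases hi : i - (t : ZMod n) = i'
      · simp only [φ, LinearMap.comp_apply, Algebra.lsmul_coe, ← hi]
        rw [e_sub_smul_x_pow_smul hv.e_smul, hg' ⟨t, ht⟩]
        simp [Ne.symm h]
      · rw [← e_sub_smul_x_pow_smul hv.e_smul, hφe, if_neg (Ne.symm hi)]
  let ρ : V →ₗ[K] V := ∑ t ∈ Finset.range l,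
    (φ ∘ₗ Algebra.lsmul K K V (S.x ^ (l - 1 - t))).smulRight (S.x ^ t • v)
  have hρ (w : V) : ρ w = ∑ t ∈ Finset.range l, φ (S.x ^ (l - 1 - t) • w) • S.x ^ t • v := by
    simp [ρ, -map_pow]
  have hlin := map_smul_of_commute (S := S) ρ (fun w => by
    rw [hρ, hρ, Finset.smul_sum]
    obtain ⟨m, rfl⟩ : ∃ m, l = m + 1 := ⟨l - 1, by lia⟩
    rw [Finset.sum_range_succ', Finset.sum_range_succ]
    congr 1
    · refine Finset.sum_congr rfl fun t ht => ?_
      rw [smul_tower_comm, smul_smul, smul_smul, ← pow_succ, ← pow_succ']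
      congr 4
      have := Finset.mem_range.1 ht
      lia
    · rw [smul_smul, ← pow_succ, smul_tower_comm, smul_smul, ← pow_succ', hv.x_pow_smul,
        show m + 1 - 1 - 0 + 1 = m + 1 by lia, hmax]
      simp) (fun j w => by
    rw [hρ, hρ, Finset.smul_sum]
    refine Finset.sum_congr rfl fun t ht => ?_
    have htl := Finset.mem_range.1 ht
    have hj : i' + (l - 1 - t : ℕ) = i - t := by
      simp only [i']
      rw [show l - 1 = (l - 1 - t) + t by lia]
      push_cast
      rw [show l - 1 - t + t - t = l - 1 - t by lia]
      ring
    have key : φ (S.x ^ (l - 1 - t) • S.e j • w) =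
        if i - t = j then φ (S.x ^ (l - 1 - t) • w) else 0 := by
      rw [show j = j - (l - 1 - t : ℕ) + (l - 1 - t : ℕ) by ring, ← e_smul_x_pow_smul, hφe]
      simp only [← hj, sub_add_cancel, eq_sub_iff_add_eq]
    rw [key, smul_tower_comm]
    split_ifs with h
    · rw [← h, e_sub_smul_x_pow_smul hv.e_smul]
    · rw [e_smul_of_ne (e_sub_smul_x_pow_smul hv.e_smul t) (Ne.symm h), smul_zero, zero_smul])
  refine ⟨{ toFun := ρ, map_add' := ρ.map_add, map_smul' := hlin }, fun w => ?_, ?_⟩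
  · change ρ w ∈ _
    rw [hρ]
    refine Submodule.sum_mem _ fun t _ => ?_
    rw [← algebraMap_smul A, smul_smul]
    exact Submodule.smul_mem _ _ (Submodule.mem_span_singleton_self v)
  · change ρ v = v
    rw [hρ, Finset.sum_eq_single_of_mem 0 (by simpa using hl)]
    · rw [hφv _ (by lia)]
      simp
    · intro t ht h0
      have := Finset.mem_range.1 ht
      rw [hφv _ (by lia), if_neg (by lia), zero_smul]

end CyclicPresentation

theorem CategoryTheory.Indecomposable.eq_bot_or_eq_bot {A : Type*} [Ring A] {M : ModuleCat.{u} A}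
    (hM : Indecomposable M) {p q : Submodule A M} (h : IsCompl p q) : p = ⊥ ∨ q = ⊥ := by
  have e : M ≅ ModuleCat.of A p ⊞ ModuleCat.of A q :=
    (Submodule.prodEquivOfIsCompl p q h).symm.toModuleIso ≪≫
      (ModuleCat.biprodIsoProd (ModuleCat.of A p) (ModuleCat.of A q)).symm
  refine (hM.2 _ _ e).imp (fun hz => ?_) (fun hz => ?_)
  · have : Subsingleton p := ModuleCat.isZero_iff_subsingleton.1 hz
    exact Submodule.eq_bot_of_subsingleton
  · have : Subsingleton q := ModuleCat.isZero_iff_subsingleton.1 hz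
    exact Submodule.eq_bot_of_subsingleton

namespace CyclicPresentation

variable {K : Type*} {A : Type u} [Field K] [Ring A] [Algebra K A] {n : ℕ} [NeZero n] {L : ℕ}
  (S : CyclicPresentation K A n L)

/-- An indecomposable module is generated by a homogeneous element: an element of maximal order
generates a direct summand. -/
theorem exists_generator_of_indecomposable (M : ModuleCat.{u} A) [Module K M] [IsScalarTower K A M]
    (hM : Indecomposable M) :
    ∃ (v : M) (i : ZMod n) (l : ℕ), S.HasOrder v i l ∧ Submodule.span A {v} = ⊤ ∧ v ≠ 0 := by
  classical
  have hex : ∃ l, ∀ w : M, S.x ^ l • w = 0 := ⟨L + 1, fun w => by rw [S.x_pow, zero_smul]⟩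
  have hmax := Nat.find_spec hex
  set l := Nat.find hex with hl
  have hnt : Nontrivial M := by
    rw [← not_subsingleton_iff_nontrivial, ← ModuleCat.isZero_iff_subsingleton]
    exact hM.1
  have hl0 : 0 < l := by
    rw [Nat.pos_iff_ne_zero]
    intro h0
    obtain ⟨w, hw⟩ := exists_ne (0 : M)
    exact hw (by simpa [h0] using hmax w)
  obtain ⟨w, hw⟩ := not_forall.1 (Nat.find_min hex (m := l - 1) (by lia))
  obtain ⟨j, hj⟩ : ∃ j, S.x ^ (l - 1) • S.e j • w ≠ 0 := by
    by_contra! h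
    refine hw ?_
    rw [← one_smul A w, ← S.sum_e, Finset.sum_smul, Finset.smul_sum]
    exact Finset.sum_eq_zero fun j _ => h j
  have hv : S.HasOrder (S.e j • w) j l :=
    ⟨by rw [smul_smul, S.e_mul_e, if_pos rfl], hmax _,
      fun t ht h => hj (x_pow_smul_eq_zero h (by lia))⟩
  have hv0 : S.e j • w ≠ 0 := fun h => hj (by rw [h, smul_zero])
  refine ⟨S.e j • w, j, l, hv, ?_, hv0⟩
  obtain ⟨ρ, hρ, hρv⟩ := hv.exists_retraction (K := K) hmax
  have hc := LinearMap.isCompl_of_proj (f := ρ.codRestrict _ hρ) fun y => by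
    obtain ⟨y, hy⟩ := y
    obtain ⟨a, rfl⟩ := Submodule.mem_span_singleton.1 hy
    ext
    simp only [LinearMap.codRestrict_apply, map_smul ρ a, hρv]
  rcases hM.eq_bot_or_eq_bot hc with h | h
  · exact absurd (Submodule.span_singleton_eq_bot.1 h) hv0
  · rw [h] at hc
    exact eq_top_of_isCompl_bot hc

/-! ### Projective covers and minimal presentations -/

variable {S}

/-- A projective cover of a module `A v` is of the form `A p` with `p` a lift of `v`, and `p` has the
maximal order: if `x ^ L • p = 0`, then a section of `A → A p` gives an element `y` of `A e i` with
`y • p = p` and `x ^ L * y = 0`, so `y` has no constant term and `p` is a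
combination of the `x ^ t • p` with `t > 0`, which is impossible for `p ≠ 0`. -/
theorem exists_generator_of_isProjectiveCover {P V : Type u} [AddCommGroup P] [Module A P]
    [Module K P] [IsScalarTower K A P] [AddCommGroup V] [Module A V] {π : P →ₗ[A] V}
    (hπ : IsProjectiveCover π) {v : V} {i : ZMod n} (hv : S.e i • v = v)
    (hspan : Submodule.span A {v} = ⊤) (hv0 : v ≠ 0) :
    ∃ p : P, π p = v ∧ S.HasOrder p i (L + 1) ∧ Submodule.span A {p} = ⊤ := by
  obtain ⟨p', hp'⟩ := hπ.surjective v
  obtain ⟨p, hpdef⟩ : ∃ p, p = S.e i • p' := ⟨_, rfl⟩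
  have hpv : π p = v := by rw [hpdef, map_smul, hp', hv]
  have hpi : S.e i • p = p := by rw [hpdef, smul_smul, S.e_mul_e, if_pos rfl]
  have hp0 : p ≠ 0 := by rintro rfl; exact hv0 (by rw [← hpv, map_zero])
  have hptop : Submodule.span A {p} = ⊤ := by
    refine hπ.superfluous _ (eq_top_iff.2 fun w _ => ?_)
    obtain ⟨a, ha⟩ := Submodule.mem_span_singleton.1 (hspan ▸ Submodule.mem_top : π w ∈ _)
    rw [← add_sub_cancel (a • p) w]
    refine Submodule.add_mem_sup (Submodule.smul_mem _ _ (Submodule.mem_span_singleton_self p)) ?_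
    rw [LinearMap.mem_ker, map_sub, map_smul, hpv, ha, sub_self]
  refine ⟨p, hpv, ?_, hptop⟩
  obtain ⟨l, hl, ho⟩ := S.exists_hasOrder hpi
  rcases hl.eq_or_lt with rfl | hlt
  · exact ho
  exfalso
  have hl0 := ho.pos hp0
  have hproj := hπ.projective
  obtain ⟨s, hs⟩ := Module.projective_lifting_property (LinearMap.toSpanSingleton A P p)
    LinearMap.id (by rwa [← LinearMap.range_eq_top, LinearMap.range_toSpanSingleton])
  have hsp : s p • p = p := by simpa using LinearMap.congr_fun hs p
  obtain ⟨c, hc⟩ := exists_eq_sum_of_mem_span (K := K) (w := s p * S.e i) (hasOrder_e i).e_smul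
    (hasOrder_e i).x_pow_smul (Submodule.smul_mem _ (s p) (Submodule.mem_span_singleton_self _))
  have hz : S.x ^ L * (s p * S.e i) = 0 := by
    rw [← mul_assoc, ← smul_eq_mul, ← smul_eq_mul, ← map_smul,
      x_pow_smul_eq_zero ho.x_pow_smul (by lia), map_zero, zero_smul]
  have hc0 : c 0 = 0 := by
    rw [hc, Finset.mul_sum, Finset.sum_eq_single_of_mem 0 (by simp)] at hz
    · rw [pow_zero, one_smul, mul_smul_comm, smul_eq_zero] at hz
      exact hz.resolve_right (S.x_pow_mul_e_ne_zero i)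
    · intro t _ ht
      rw [mul_smul_comm, smul_eq_mul, ← mul_assoc, ← pow_add,
        pow_eq_zero_of_le (by lia) S.x_pow, zero_mul, smul_zero]
  refine ho.x_pow_smul_ne (l - 1) (by lia) ?_
  -- the term for `t = 0` is missing, so `x ^ (l - 1)` kills this expression of `p`
  have hp : p = ∑ t ∈ Finset.range (L + 1), c t • S.x ^ t • p := by
    conv_lhs => rw [← hsp]
    conv_lhs => rw [← hpi, smul_smul, hpi, hc, Finset.sum_smul]
    refine Finset.sum_congr rfl fun t _ => ?_
    rw [smul_assoc, smul_assoc, hpi]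
  rw [hp, Finset.smul_sum]
  refine Finset.sum_eq_zero fun t _ => ?_
  rcases Nat.eq_zero_or_pos t with rfl | ht
  · rw [hc0, zero_smul, smul_zero]
  · rw [smul_tower_comm, smul_smul, ← pow_add, x_pow_smul_eq_zero ho.x_pow_smul (by lia),
      smul_zero]

/-- A homogeneous generator of maximal order is a free generator: as the `x ^ t • p` with `t ≤ L` are
linearly independent, every `a` with `a • p = 0` satisfies `a * e j = 0`. -/
theorem HasOrder.exists_hom {P V : Type*} [AddCommGroup P] [Module A P]
    [Module K P] [IsScalarTower K A P] [AddCommGroup V] [Module A V] {p : P} {j : ZMod n}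
    (hp : S.HasOrder p j (L + 1)) (htop : Submodule.span A {p} = ⊤) {v : V} (hv : S.e j • v = v) :
    ∃ h : P →ₗ[A] V, h p = v := by
  have hsurj : Function.Surjective (LinearMap.toSpanSingleton A P p) := by
    rwa [← LinearMap.range_eq_top, LinearMap.range_toSpanSingleton]
  have hker : LinearMap.ker (LinearMap.toSpanSingleton A P p) ≤
      LinearMap.ker (LinearMap.toSpanSingleton A V v) := by
    intro a ha
    rw [LinearMap.mem_ker, LinearMap.toSpanSingleton_apply] at ha ⊢
    obtain ⟨c, hc⟩ := exists_eq_sum_of_mem_span (K := K) (w := a * S.e j) (hasOrder_e j).e_smul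
      (hasOrder_e j).x_pow_smul (Submodule.smul_mem _ a (Submodule.mem_span_singleton_self _))
    have h0 : ∑ t ∈ Finset.range (L + 1), c t • S.x ^ t • p = 0 := by
      rw [← hp.e_smul, smul_smul, hc, Finset.sum_smul] at ha
      rw [← ha]
      refine Finset.sum_congr rfl fun t _ => ?_
      rw [smul_assoc, smul_assoc, hp.e_smul]
    rw [← hv, smul_smul, hc, Finset.sum_eq_zero, zero_smul]
    intro t ht
    have := Finset.mem_range.1 ht
    rw [hp.coeff_eq_zero h0 this this, zero_smul]
  refine ⟨(Submodule.liftQ _ _ hker) ∘ₗ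
    ((LinearMap.toSpanSingleton A P p).quotKerEquivOfSurjective hsurj).symm.toLinearMap, ?_⟩
  have : ((LinearMap.toSpanSingleton A P p).quotKerEquivOfSurjective hsurj).symm p =
      Submodule.Quotient.mk 1 := by
    rw [LinearEquiv.symm_apply_eq, LinearMap.quotKerEquivOfSurjective_apply_mk]
    simp
  simp only [LinearMap.comp_apply, LinearEquiv.coe_coe]
  rw [this, Submodule.liftQ_apply]
  simp

variable (S) in
/-- The minimal projective presentation of an indecomposable non-projective module of length `l` is
the map `A p₀ → A p₁` of free modules on one vertex each that sends `p₀` to `x ^ l • p₁`. -/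
theorem exists_generators_of_minimalProjectivePresentation {M : ModuleCat.{u} A}
    (hM : Indecomposable M) (hproj : ¬ Module.Projective A M)
    (T : MinimalProjectivePresentation M)
    [Module K M] [IsScalarTower K A M] [Module K T.P₀] [IsScalarTower K A T.P₀]
    [Module K T.P₁] [IsScalarTower K A T.P₁] :
    ∃ (l : ℕ) (i : ZMod n) (p₀ : T.P₀) (p₁ : T.P₁), 0 < l ∧ l ≤ L ∧ Module.length A M = l ∧
      S.HasOrder p₀ (i - l) (L + 1) ∧ Submodule.span A {p₀} = ⊤ ∧
      S.HasOrder p₁ i (L + 1) ∧ Submodule.span A {p₁} = ⊤ ∧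
      T.f.hom p₀ = S.x ^ l • p₁ := by
  obtain ⟨m, i, l, hm, hmtop, hm0⟩ := S.exists_generator_of_indecomposable M hM
  obtain ⟨p₁, hp₁m, hp₁, hp₁top⟩ :=
    exists_generator_of_isProjectiveCover T.cover₁ hm.e_smul hmtop hm0
  have hker (w : T.P₁) (hw : T.π.hom w = 0) : w ∈ Submodule.span A {S.x ^ l • p₁} := by
    obtain ⟨c, rfl⟩ := exists_eq_sum_of_mem_span (K := K) hp₁.e_smul hp₁.x_pow_smul
      (hp₁top ▸ Submodule.mem_top : w ∈ _)
    have hw' : ∑ t ∈ Finset.range (L + 1), c t • S.x ^ t • m = 0 := by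
      rw [← hw, map_sum]
      refine Finset.sum_congr rfl fun t _ => ?_
      rw [LinearMap.map_smul_of_tower, map_smul, hp₁m]
    refine Submodule.sum_mem _ fun t ht => ?_
    by_cases htl : t < l
    · rw [hm.coeff_eq_zero hw' htl (by simpa using ht), zero_smul]
      exact Submodule.zero_mem _
    · rw [← Nat.sub_add_cancel (not_lt.1 htl), pow_add, mul_smul, ← algebraMap_smul A]
      exact Submodule.smul_mem _ _ (Submodule.smul_mem _ _ (Submodule.mem_span_singleton_self _))
  have hlL : l ≤ L := by
    by_contra! h
    have hl : l = L + 1 := le_antisymm hm.le h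
    have hinj : Function.Injective T.π.hom := by
      rw [← LinearMap.ker_eq_bot, eq_bot_iff]
      intro w hw
      have := hker w hw
      rwa [hl, hp₁.x_pow_smul, Submodule.span_singleton_eq_bot.2 rfl] at this
    have := T.cover₁.projective
    exact hproj (Module.Projective.of_equiv
      (LinearEquiv.ofBijective T.π.hom ⟨hinj, T.cover₁.surjective⟩))
  have hq : S.x ^ l • p₁ ∈ LinearMap.range T.f.hom := by
    rw [T.exact, LinearMap.mem_ker, map_smul, hp₁m, hm.x_pow_smul]
  obtain ⟨p₀, hp₀q, hp₀, hp₀top⟩ := exists_generator_of_isProjectiveCover (S := S) (K := K) T.cover₀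
    (v := ⟨S.x ^ l • p₁, hq⟩) (i := i - l)
    (Subtype.ext (e_sub_smul_x_pow_smul hp₁.e_smul l)) (by
      refine eq_top_iff.2 fun w _ => ?_
      obtain ⟨w, hw⟩ := w
      obtain ⟨a, rfl⟩ := Submodule.mem_span_singleton.1
        (hker w (by rw [T.exact] at hw; exact hw))
      exact Submodule.mem_span_singleton.2 ⟨a, rfl⟩)
    (fun h => hp₁.x_pow_smul_ne l (by lia) (congrArg Subtype.val h))
  exact ⟨l, i, p₀, p₁, hm.pos hm0, hlL, length_eq_of_hasOrder (K := K) hm hmtop, hp₀, hp₀top, hp₁,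
    hp₁top, congrArg Subtype.val hp₀q⟩

/-! ### Morphisms between the terms of the presentation -/

section Hom

variable {P₀ P₁ : Type*} [AddCommGroup P₀] [Module A P₀] [AddCommGroup P₁] [Module A P₁]
  {i : ZMod n} {l : ℕ} {p₀ : P₀} {p₁ : P₁} {f : P₀ →ₗ[A] P₁}

theorem ext_of_span {V W : Type*} [AddCommGroup V] [Module A V] [AddCommGroup W] [Module A W]
    {v : V} (htop : Submodule.span A {v} = ⊤) {g h : V →ₗ[A] W} (hgh : g v = h v) : g = h :=
  LinearMap.ext_on htop (by simpa using hgh)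

/-- If `l < n`, every power of `x` leading from the vertex of `p₁` to that of `p₀` is a multiple of
`x ^ l`, so every morphism `P₀ → P₁` factors through `f`. -/
theorem exists_comp_eq_of_lt [Module K P₁] [IsScalarTower K A P₁]
    (hp₀ : S.HasOrder p₀ (i - l) (L + 1))
    (hp₀top : Submodule.span A {p₀} = ⊤) (hp₁ : S.HasOrder p₁ i (L + 1))
    (hp₁top : Submodule.span A {p₁} = ⊤) (hf : f p₀ = S.x ^ l • p₁) (hl : l < n)
    (g : P₀ →ₗ[A] P₁) : ∃ b : P₁ →ₗ[A] P₁, g = b ∘ₗ f := by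
  obtain ⟨c, hc, hcv⟩ := exists_eq_sum_of_mem_span_of_e_smul (K := K) hp₁.e_smul hp₁.x_pow_smul
    (hp₁top ▸ Submodule.mem_top : g p₀ ∈ _) (by rw [← map_smul, hp₀.e_smul])
  have hlt (t : ℕ) (ht : c t ≠ 0) : l ≤ t := by
    have h := sub_right_injective (hcv t ht)
    have := (ZMod.natCast_eq_natCast_iff' _ _ _).1 h
    rw [Nat.mod_eq_of_lt hl] at this
    exact this ▸ Nat.mod_le _ _
  have hi (t : ℕ) (ht : c t ≠ 0) : S.e i • S.x ^ (t - l) • p₁ = S.x ^ (t - l) • p₁ := by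
    have : i - ((t - l : ℕ) : ZMod n) = i := by
      rw [Nat.cast_sub (hlt t ht), sub_right_injective (hcv t ht)]
      simp
    conv_lhs => rw [← this]
    exact e_sub_smul_x_pow_smul hp₁.e_smul _
  obtain ⟨b, hb⟩ := hp₁.exists_hom (K := K) hp₁top
    (v := ∑ t ∈ Finset.range (L + 1), c t • S.x ^ (t - l) • p₁) (by
      rw [Finset.smul_sum]
      refine Finset.sum_congr rfl fun t _ => ?_
      by_cases ht : c t = 0
      · simp [ht]
      · rw [smul_tower_comm, hi t ht])
  refine ⟨b, ext_of_span hp₀top ?_⟩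
  rw [LinearMap.comp_apply, hf, map_smul, hb, hc, Finset.smul_sum]
  refine Finset.sum_congr rfl fun t _ => ?_
  by_cases ht : c t = 0
  · simp [ht]
  · rw [smul_tower_comm, smul_smul, ← pow_add, Nat.add_sub_cancel' (hlt t ht)]

/-- If `l < n` and `g : P₁ → P₀` satisfies `g ∘ f = 0`, then `g p₁` only involves powers `x ^ t`
with `t + l > L` and `n ∣ t + l`. As `n ∣ L`, this forces `t + l ≥ L + n`, so `t > L`. -/
theorem eq_zero_of_comp_eq_zero [Module K P₀] [IsScalarTower K A P₀]
    (hp₀ : S.HasOrder p₀ (i - l) (L + 1))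
    (hp₀top : Submodule.span A {p₀} = ⊤) (hp₁ : S.HasOrder p₁ i (L + 1))
    (hp₁top : Submodule.span A {p₁} = ⊤) (hf : f p₀ = S.x ^ l • p₁) (hl : l < n)
    (hL : n ∣ L) (g : P₁ →ₗ[A] P₀) (hg : g ∘ₗ f = 0) : g = 0 := by
  obtain ⟨c, hc, hcv⟩ := exists_eq_sum_of_mem_span_of_e_smul (K := K) hp₀.e_smul hp₀.x_pow_smul
    (hp₀top ▸ Submodule.mem_top : g p₁ ∈ _) (by rw [← map_smul, hp₁.e_smul])
  have h0 : S.x ^ l • g p₁ = 0 := by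
    rw [← map_smul, ← hf]; exact LinearMap.congr_fun hg p₀
  refine ext_of_span hp₁top ?_
  rw [hc, LinearMap.zero_apply]
  refine Finset.sum_eq_zero fun t ht => ?_
  have htL := Finset.mem_range.1 ht
  by_contra hne
  have hct : c t ≠ 0 := fun h => hne (by rw [h, zero_smul])
  have hdvd : n ∣ l + t := by
    rw [← ZMod.natCast_eq_zero_iff]
    have := hcv t hct
    rw [sub_sub, sub_eq_self] at this
    exact_mod_cast this
  have hle : l + t ≤ L := by
    obtain ⟨k, rfl⟩ := hL
    obtain ⟨r, hr⟩ := hdvd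
    rw [hr]
    refine Nat.mul_le_mul_left _ (Nat.lt_succ_iff.1 ?_)
    refine Nat.lt_of_mul_lt_mul_left (a := n) ?_
    rw [← hr, Nat.succ_eq_add_one, mul_add]
    lia
  have h1 : ∑ s ∈ Finset.range (L + 1), c s • S.x ^ s • (S.x ^ l • p₀) = 0 := by
    rw [← h0, hc, Finset.smul_sum]
    refine Finset.sum_congr rfl fun s _ => ?_
    rw [smul_tower_comm, smul_smul, smul_smul, ← pow_add, ← pow_add, add_comm]
  exact hct ((hp₀.x_pow_smul_right (t := l) (by lia)).coeff_eq_zero h1 (by lia) htL)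

/-- If `n ≤ l`, the morphism `P₀ → P₁` given by `x ^ (l - n)` is not null-homotopic: the image of a
null-homotopic one is annihilated by `x ^ (L + 1 - l)`. -/
theorem exists_ne_comp_add_comp [Module K P₀] [IsScalarTower K A P₀] [Module K P₁]
    [IsScalarTower K A P₁]
    (hp₀ : S.HasOrder p₀ (i - l) (L + 1))
    (hp₀top : Submodule.span A {p₀} = ⊤) (hp₁ : S.HasOrder p₁ i (L + 1))
    (hf : f p₀ = S.x ^ l • p₁) (hlL : l ≤ L) (hl : n ≤ l) :
    ∃ g : P₀ →ₗ[A] P₁, ∀ (a : P₀ →ₗ[A] P₀) (b : P₁ →ₗ[A] P₁), g ≠ f ∘ₗ a + b ∘ₗ f := by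
  obtain ⟨g, hg⟩ := hp₀.exists_hom (K := K) hp₀top (v := S.x ^ (l - n) • p₁) (by
    have := e_sub_smul_x_pow_smul hp₁.e_smul (l - n)
    rwa [Nat.cast_sub hl, ZMod.natCast_self, sub_zero] at this)
  refine ⟨g, fun a b h => ?_⟩
  have hfx (w : P₀) : S.x ^ (L + 1 - l) • f w = 0 := by
    obtain ⟨c, rfl⟩ := exists_eq_sum_of_mem_span (K := K) hp₀.e_smul hp₀.x_pow_smul
      (hp₀top ▸ Submodule.mem_top : w ∈ _)
    rw [map_sum, Finset.smul_sum]
    refine Finset.sum_eq_zero fun t _ => ?_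
    rw [LinearMap.map_smul_of_tower, map_smul, hf, smul_tower_comm, smul_smul, smul_smul,
      ← pow_add, ← pow_add, x_pow_smul_eq_zero hp₁.x_pow_smul (by lia), smul_zero]
  have h1 : S.x ^ (L + 1 - l) • g p₀ = 0 := by
    rw [h, LinearMap.add_apply, smul_add, LinearMap.comp_apply, LinearMap.comp_apply, hfx,
      ← map_smul, hfx, map_zero, add_zero]
  rw [hg, smul_smul, ← pow_add] at h1
  have hn := NeZero.pos n
  exact hp₁.x_pow_smul_ne _ (by lia) h1

end Hom

end CyclicPresentation

/-! ### The ideal of long paths -/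

namespace PathAlgebra

variable (K : Type u) [Field K] {V : Type} [Quiver.{0} V]

theorem span_of_eq_top : Submodule.span K (Set.range (of K (V := V))) = ⊤ := by
  refine eq_top_iff.2 fun x _ => ?_
  induction x using induction_on with
  | zero => exact Submodule.zero_mem _
  | add x y hx hy => exact Submodule.add_mem _ (hx trivial) (hy trivial)
  | smul c p => exact Submodule.smul_mem _ _ (Submodule.subset_span ⟨p, rfl⟩)

/-- The subspace spanned by the paths of length at least `N`. -/
noncomputable def longPaths (V : Type) [Quiver.{0} V] (N : ℕ) : Submodule K (PathAlgebra K V) :=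
  Submodule.span K (of K '' {p : Quiver.AnyPath V | N ≤ p.2.2.length})

variable {K} {N : ℕ}

theorem of_mul_of_mem_longPaths {p q : Quiver.AnyPath V}
    (h : N ≤ p.2.2.length + q.2.2.length) : of K p * of K q ∈ longPaths K V N := by
  obtain ⟨a, b, p⟩ := p
  obtain ⟨b', c, q⟩ := q
  by_cases hb : b' = b
  · subst hb
    rw [of_mul_of_comp]
    exact Submodule.subset_span ⟨_, by simpa using h, rfl⟩
  · rw [of_mul_of_ne K _ _ hb]
    exact Submodule.zero_mem _

variable [Fintype V]

theorem mul_mem_longPaths_left {x y : PathAlgebra K V} (hy : y ∈ longPaths K V N) :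
    x * y ∈ longPaths K V N := by
  induction hy using Submodule.span_induction with
  | mem y hy =>
    obtain ⟨q, hq, rfl⟩ := hy
    induction x using induction_on with
    | zero => rw [zero_mul]; exact Submodule.zero_mem _
    | add x y hx hy => rw [add_mul]; exact Submodule.add_mem _ hx hy
    | smul c p =>
      rw [smul_mul_assoc]
      exact Submodule.smul_mem _ _ (of_mul_of_mem_longPaths (le_add_left hq))
  | zero => rw [mul_zero]; exact Submodule.zero_mem _
  | add y z _ _ hy hz => rw [mul_add]; exact Submodule.add_mem _ hy hz
  | smul c y _ hy => rw [mul_smul_comm]; exact Submodule.smul_mem _ _ hy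

theorem mul_mem_longPaths_right {x y : PathAlgebra K V} (hx : x ∈ longPaths K V N) :
    x * y ∈ longPaths K V N := by
  induction hx using Submodule.span_induction with
  | mem x hx =>
    obtain ⟨p, hp, rfl⟩ := hx
    induction y using induction_on with
    | zero => rw [mul_zero]; exact Submodule.zero_mem _
    | add x y hx hy => rw [mul_add]; exact Submodule.add_mem _ hx hy
    | smul c q =>
      rw [mul_smul_comm]
      exact Submodule.smul_mem _ _ (of_mul_of_mem_longPaths (le_add_right hp))
  | zero => rw [zero_mul]; exact Submodule.zero_mem _
  | add y z _ _ hy hz => rw [add_mul]; exact Submodule.add_mem _ hy hz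
  | smul c y _ hy => rw [smul_mul_assoc]; exact Submodule.smul_mem _ _ hy

variable (K V N) in
/-- The two-sided ideal spanned by the paths of length at least `N`. -/
noncomputable def longPathIdeal : TwoSidedIdeal (PathAlgebra K V) :=
  TwoSidedIdeal.mk' (longPaths K V N) (Submodule.zero_mem _) (Submodule.add_mem _)
    (Submodule.neg_mem _) mul_mem_longPaths_left mul_mem_longPaths_right

theorem of_notMem_longPathIdeal {p : Quiver.AnyPath V} (hp : p.2.2.length < N) :
    of K p ∉ longPathIdeal K V N := by
  intro h
  have h' : of K p ∈ longPaths K V N := by simpa [longPathIdeal] using h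
  let coeff : PathAlgebra K V →ₗ[K] K := Finsupp.lapply (R := K) (M := K) p
  have hle : longPaths K V N ≤ LinearMap.ker coeff := by
    refine Submodule.span_le.2 ?_
    rintro _ ⟨q, hq, rfl⟩
    have : q ≠ p := by rintro rfl; exact absurd hq (not_le.2 hp)
    exact Finsupp.single_eq_of_ne this.symm
  have h1 : coeff (of K p) = 1 := Finsupp.single_eq_same
  exact one_ne_zero (h1.symm.trans (hle h'))

end PathAlgebra

/-! ### Generators of the Brauer star algebra -/

namespace BrauerStar

variable (K : Type u) [Field K] (n : ℕ) [NeZero n]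

/-- The path of length zero at the vertex `i`. -/
noncomputable def idem (i : ZMod n) : PathAlgebra K (ZMod n) :=
  PathAlgebra.of K ⟨i, i, Quiver.Path.nil⟩

/-- The sum of all arrows. -/
noncomputable def arrowSum : PathAlgebra K (ZMod n) := ∑ i, α K n i

variable {K n}

theorem idem_mul_idem (i j : ZMod n) :
    idem K n i * idem K n j = if i = j then idem K n i else 0 := by
  unfold idem
  split_ifs with h
  · subst h
    rw [PathAlgebra.of_mul_of_comp, Quiver.Path.comp_nil]
  · exact PathAlgebra.of_mul_of_ne K _ _ (Ne.symm h)

theorem idem_mul_α (i j : ZMod n) : idem K n i * α K n j = if i = j then α K n j else 0 := by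
  unfold idem α
  split_ifs with h
  · subst h
    rw [PathAlgebra.of_mul_of_comp, Quiver.Path.nil_comp]
  · exact PathAlgebra.of_mul_of_ne K _ _ (Ne.symm h)

theorem α_mul_idem (i j : ZMod n) : α K n i * idem K n j = if i + 1 = j then α K n i else 0 := by
  unfold idem α
  split_ifs with h
  · subst h
    rw [PathAlgebra.of_mul_of_comp, Quiver.Path.comp_nil]
  · exact PathAlgebra.of_mul_of_ne K _ _ (Ne.symm h)

theorem idem_mul_arrowSum (i : ZMod n) : idem K n i * arrowSum K n = α K n i := by
  simp [arrowSum, Finset.mul_sum, idem_mul_α]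

theorem arrowSum_mul_idem (i : ZMod n) : arrowSum K n * idem K n (i + 1) = α K n i := by
  simp [arrowSum, Finset.sum_mul, α_mul_idem]

theorem sum_idem : ∑ i, idem K n i = 1 := rfl

theorem idem_mul_arrowSum_pow (i : ZMod n) (t : ℕ) :
    idem K n i * arrowSum K n ^ t = arrowSum K n ^ t * idem K n (i + t) := by
  induction t with
  | zero => simp
  | succ t ih =>
    rw [pow_succ, ← mul_assoc, ih, mul_assoc, idem_mul_arrowSum, ← arrowSum_mul_idem, mul_assoc]
    congr 3
    push_cast
    ring

/-- A path in the cyclic quiver is determined by its length and its end. -/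
theorem of_eq_arrowSum_pow_mul_idem {a b : ZMod n} (p : Quiver.Path a b) :
    PathAlgebra.of K ⟨a, b, p⟩ = arrowSum K n ^ p.length * idem K n b := by
  induction p with
  | nil => simp [idem]
  | @cons b c p f ih =>
    obtain ⟨rfl⟩ := f
    have : PathAlgebra.of K ⟨a, b + 1, p.cons (cyclicQuiver.arrow n b)⟩ =
        PathAlgebra.of K ⟨a, b, p⟩ * α K n b := by
      unfold α
      rw [PathAlgebra.of_mul_of_comp, Quiver.Path.comp_toPath_eq_cons]
    refine this.trans ?_
    rw [ih, mul_assoc, idem_mul_α, if_pos rfl, ← arrowSum_mul_idem, ← mul_assoc, ← pow_succ]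
    rfl

omit [NeZero n] in
theorem exists_path_length_eq (t : ℕ) (j : ZMod n) :
    ∃ (a : ZMod n) (p : Quiver.Path a j), p.length = t := by
  induction t generalizing j with
  | zero => exact ⟨j, Quiver.Path.nil, rfl⟩
  | succ t ih =>
    obtain ⟨i, rfl⟩ : ∃ i, j = i + 1 := ⟨j - 1, by ring⟩
    obtain ⟨a, p, hp⟩ := ih i
    exact ⟨a, p.cons (cyclicQuiver.arrow n i), by simp [hp]⟩

/-- The path with `m + 1` arrows starting at `i`. -/
theorem prod_α (i : ZMod n) (m : ℕ) :
    ((List.range (m + 1)).map fun j : ℕ => α K n (i + (j : ZMod n))).prod =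
      idem K n i * arrowSum K n ^ (m + 1) := by
  induction m with
  | zero => simp [idem_mul_arrowSum]
  | succ m ih =>
    rw [List.range_succ, List.map_append, List.prod_append, ih, pow_succ _ (m + 1),
      ← mul_assoc, idem_mul_arrowSum_pow]
    simp [mul_assoc, idem_mul_α, idem_mul_arrowSum]

theorem cycle_eq (i : ZMod n) : cycle K n i = idem K n i * arrowSum K n ^ n := by
  have h := prod_α (K := K) i (n - 1)
  rwa [Nat.sub_add_cancel (NeZero.pos n)] at h

/-- The full cycles commute with the vertices. -/
theorem idem_mul_arrowSum_pow_mul (i : ZMod n) (m : ℕ) :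
    idem K n i * arrowSum K n ^ (n * m) = arrowSum K n ^ (n * m) * idem K n i := by
  rw [idem_mul_arrowSum_pow]
  simp

theorem cycle_pow_mul_α (i : ZMod n) {k : ℕ} (hk : 1 ≤ k) :
    cycle K n i ^ k * α K n i = idem K n i * arrowSum K n ^ (n * k + 1) := by
  have hii : idem K n i * idem K n i = idem K n i := by rw [idem_mul_idem, if_pos rfl]
  have hpow : cycle K n i ^ k = idem K n i * arrowSum K n ^ (n * k) := by
    induction k, hk using Nat.le_induction with
    | base => simp [cycle_eq]
    | succ k _ ih =>
      rw [pow_succ, ih, cycle_eq, idem_mul_arrowSum_pow_mul, mul_assoc, ← mul_assoc (idem K n i),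
        hii, ← mul_assoc, ← idem_mul_arrowSum_pow_mul, mul_assoc, ← pow_add, mul_add_one]
  rw [hpow, ← idem_mul_arrowSum, idem_mul_arrowSum_pow_mul, mul_assoc, ← mul_assoc (idem K n i),
    hii, ← mul_assoc, ← idem_mul_arrowSum_pow_mul, mul_assoc, ← pow_succ]

theorem arrowSum_pow_mem_relations {k : ℕ} (hk : 1 ≤ k) :
    arrowSum K n ^ (n * k + 1) ∈ relations K n k := by
  rw [← one_mul (arrowSum K n ^ _), ← sum_idem, Finset.sum_mul]
  refine sum_mem fun i _ => ?_
  rw [← cycle_pow_mul_α i hk]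
  exact TwoSidedIdeal.subset_span ⟨i, rfl⟩

/-- The relations are paths of length `n * k + 1`. -/
theorem relations_le_longPathIdeal {k : ℕ} (hk : 1 ≤ k) :
    relations K n k ≤ PathAlgebra.longPathIdeal K (ZMod n) (n * k + 1) := by
  refine TwoSidedIdeal.span_le.2 ?_
  rintro _ ⟨i, rfl⟩
  dsimp only
  rw [cycle_pow_mul_α i hk, idem_mul_arrowSum_pow]
  obtain ⟨a, p, hp⟩ := exists_path_length_eq (n * k + 1) (i + ((n * k + 1 : ℕ) : ZMod n))
  have h := of_eq_arrowSum_pow_mul_idem (K := K) p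
  rw [hp] at h
  rw [← h]
  have hm : PathAlgebra.of K ⟨a, _, p⟩ ∈ PathAlgebra.longPaths K (ZMod n) (n * k + 1) :=
    Submodule.subset_span ⟨_, hp.ge, rfl⟩
  simpa [PathAlgebra.longPathIdeal] using hm

theorem arrowSum_pow_mul_idem_notMem_relations {k : ℕ} (hk : 1 ≤ k) (i : ZMod n) :
    arrowSum K n ^ (n * k) * idem K n i ∉ relations K n k := by
  obtain ⟨a, p, hp⟩ := exists_path_length_eq (n * k) i
  have h := of_eq_arrowSum_pow_mul_idem (K := K) p
  rw [hp] at h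
  rw [← h]
  exact fun hmem => PathAlgebra.of_notMem_longPathIdeal (by simp [hp])
    (relations_le_longPathIdeal hk hmem)

theorem mkₐ_eq_zero_iff {k : ℕ} (a : PathAlgebra K (ZMod n)) :
    (relations K n k).ringCon.mkₐ K a = 0 ↔ a ∈ relations K n k := by
  rw [← map_zero ((relations K n k).ringCon.mkₐ K), RingCon.mkₐ_apply, RingCon.mkₐ_apply,
    RingCon.eq]
  rfl

variable (K n) in
/-- The vertices and the sum of all arrows, as generators of the Brauer star algebra. -/
noncomputable def cyclicPresentation {k : ℕ} (hk : 1 ≤ k) :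
    CyclicPresentation K (BrauerStarAlgebra K n k) n (n * k) where
  e i := (relations K n k).ringCon.mkₐ K (idem K n i)
  x := (relations K n k).ringCon.mkₐ K (arrowSum K n)
  e_mul_e i j := by
    rw [← map_mul, idem_mul_idem]
    split_ifs <;> simp
  sum_e := by rw [← map_sum, sum_idem, map_one]
  e_mul_x i := by rw [← map_mul, ← map_mul, idem_mul_arrowSum, arrowSum_mul_idem]
  x_pow := by
    rw [← map_pow, mkₐ_eq_zero_iff]
    exact arrowSum_pow_mem_relations hk
  x_pow_mul_e_ne_zero i := by
    rw [← map_pow, ← map_mul, Ne, mkₐ_eq_zero_iff]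
    exact arrowSum_pow_mul_idem_notMem_relations hk i
  span_eq_top := by
    have hs : Function.Surjective ((relations K n k).ringCon.mkₐ K).toLinearMap :=
      RingCon.mkₐ_surjective (α := K) (relations K n k).ringCon
    rw [eq_top_iff, ← LinearMap.range_eq_top.2 hs, ← Submodule.map_top,
      ← PathAlgebra.span_of_eq_top, Submodule.map_span, Submodule.span_le]
    rintro _ ⟨_, ⟨⟨a, b, p⟩, rfl⟩, rfl⟩
    refine Submodule.subset_span ⟨(p.length, b), ?_⟩
    rw [of_eq_arrowSum_pow_mul_idem]
    simp

end BrauerStar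

/-! ### The complex of a minimal projective presentation -/

theorem MinimalProjectivePresentation.isPerfect {A : Type u} [Ring A]
    [HasDerivedCategory.{w} (ModuleCat.{u} A)] {M : ModuleCat.{u} A}
    (T : MinimalProjectivePresentation M) : IsPerfect (DerivedCategory.Q.obj T.complex) := by
  refine ⟨T.complex, ⟨0, 1, fun i hi => ?_⟩, fun i => ?_, ⟨Iso.refl _⟩⟩
  · exact HomologicalComplex.isZero_double_X T.f _ i (by lia) (by lia)
  · refine HomologicalComplex.double_X_cases T.f
      (P := fun Z => Module.Finite A Z ∧ Module.Projective A Z) ⟨T.finite₀, T.cover₀.projective⟩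
      ⟨T.finite₁, T.cover₁.projective⟩ (fun Z hZ => ?_) (fun e h => ?_) _ i
    · have := ModuleCat.isZero_iff_subsingleton.1 hZ
      have := Module.Free.of_subsingleton A Z
      exact ⟨inferInstance, Module.Projective.of_free⟩
    · have := h.1
      have := h.2
      exact ⟨Module.Finite.equiv e.toLinearEquiv, Module.Projective.of_equiv e.toLinearEquiv⟩

theorem MinimalProjectivePresentation.isKProjective_complex {A : Type u} [Ring A]
    {M : ModuleCat.{u} A} (T : MinimalProjectivePresentation M) :
    CochainComplex.IsKProjective T.complex := by
  have := (IsProjective.iff_projective (T.P₀ : Type u)).1 T.cover₀.projective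
  have := (IsProjective.iff_projective (T.P₁ : Type u)).1 T.cover₁.projective
  exact HomologicalComplex.isKProjective_double T.f _

theorem proposition3 (K : Type u) [Field K] [IsAlgClosed K] (n : ℕ) [NeZero n] (k : ℕ) (hk : 1 ≤ k)
    [HasDerivedCategory.{w} (ModuleCat.{u} (BrauerStarAlgebra K n k))]
    (M : ModuleCat.{u} (BrauerStarAlgebra K n k))
    (hfin : Module.Finite (BrauerStarAlgebra K n k) M)
    (hind : Indecomposable M)
    (hproj : ¬ Module.Projective (BrauerStarAlgebra K n k) M)
    (T : MinimalProjectivePresentation M) :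
    IsPartialTilting (DerivedCategory.Q.obj T.complex) ↔
      Module.length (BrauerStarAlgebra K n k) M < n := by
  have := T.isKProjective_complex
  let (N : ModuleCat.{u} (BrauerStarAlgebra K n k)) : Module K N :=
    Module.restrictScalars K (BrauerStarAlgebra K n k) N
  have (N : ModuleCat.{u} (BrauerStarAlgebra K n k)) : IsScalarTower K (BrauerStarAlgebra K n k) N :=
    IsScalarTower.restrictScalars K (BrauerStarAlgebra K n k) N
  obtain ⟨l, i, p₀, p₁, hl0, hlL, hlen, hp₀, hp₀top, hp₁, hp₁top, hf⟩ :=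
    (BrauerStar.cyclicPresentation K n hk).exists_generators_of_minimalProjectivePresentation
      hind hproj T
  rw [hlen, Nat.cast_lt]
  constructor
  · rintro ⟨-, h⟩
    by_contra! hnl
    obtain ⟨g, hg⟩ := CyclicPresentation.exists_ne_comp_add_comp (K := K) hp₀ hp₀top hp₁ hf hlL hnl
    obtain ⟨a, b, hab⟩ := (HomologicalComplex.forall_mem_coboundaries_double_one_iff T.f (by simp)).1
      ((CochainComplex.IsKProjective.forall_Q_hom_shift_eq_zero_iff T.complex T.complex 1).1
        (h 1 one_ne_zero)) (ModuleCat.ofHom g)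
    exact hg a.hom b.hom (by simpa using congrArg ModuleCat.Hom.hom hab)
  · intro hln
    refine ⟨T.isPerfect, fun j hj => ?_⟩
    rw [CochainComplex.IsKProjective.forall_Q_hom_shift_eq_zero_iff]
    by_cases h1 : j = 1
    · subst h1
      refine (HomologicalComplex.forall_mem_coboundaries_double_one_iff T.f (by simp)).2 fun g => ?_
      obtain ⟨b, hb⟩ := CyclicPresentation.exists_comp_eq_of_lt (K := K) hp₀ hp₀top hp₁ hp₁top hf
        hln g.hom
      refine ⟨0, ModuleCat.ofHom b, ?_⟩
      ext x
      simp [hb]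
    · intro z
      suffices hz : z = 0 by rw [hz]; exact zero_mem _
      by_cases h2 : j = -1
      · subst h2
        refine HomologicalComplex.cocycle_double_neg_one_eq_zero T.f (by simp) (fun g hg _ => ?_) z
        exact ModuleCat.hom_ext (CyclicPresentation.eq_zero_of_comp_eq_zero (K := K) hp₀ hp₀top hp₁
          hp₁top hf hln (dvd_mul_right n k) g.hom (by simpa using congrArg ModuleCat.Hom.hom hg))
      · exact Subtype.ext (HomologicalComplex.cochain_double_eq_zero T.f (by simp) h1 hj h2 z.1)
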